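/- For an ideal $I$ of a noetherian ring $A$, let $\mathbf{S}(I)=\bigoplus_{n\ge 0}\mathbf{S}_n(I)$ be the symmetric algebra of the $A$-module $I$, let $\mathbf{R}(I)=\bigoplus_{n\ge 0}I^nt^n\subseteq A[t]$ be the Rees algebra, and let $\alpha:\mathbf{S}(I)\to\mathbf{R}(I)$ be the canonical graded surjection, with components $\alpha_n:\mathbf{S}_n(I)\to I^n$. For $n\ge 2$ put $E(I)_n=\ker(\alpha_n)/\mathbf{S}_1(I)\cdot\ker(\alpha_{n-1})$. Define the set of sifted degrees $\mathrm{SD}(I)=\{1\}\cup\{n\ge 2\mid E(I)_n\ne 0\}$, the sifted type $\mathrm{st}(I)=\operatorname{card}\mathrm{SD}(I)$, and the relation type $\mathrm{rt}(I)=\min\{r\ge 1\mid E(I)_n=0 \text{ for all } n\ge r+1\}$. **Proposition.** Let $A=k[a_1,a_2]$ be the polynomial ring over a field $k$. Let $p,u\in\mathbb{N}$ with $p\ge 3$, $1\le u<p/2$ and $\gcd(u,p)=1$, and let $I=(a_1^p,\;a_2^p,\;a_1^ua_2^{p-u})\subset A$. Let $q_1,\dots,q_{n-1}$ be the quotients in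 Euclid's algorithm applied to $r_0:=p$ and $r_1:=u$, i.e. $r_{i-1}=q_ir_i+r_{i+1}$ for every $1\le i\le n-1$, with $q_i,r_{i+1}\in\mathbb{N}$ and $r_0>r_1>\dots>r_{n-1}>r_n=0$. Then $$\mathrm{SD}(I)=\{d_{1,1},\dots,d_{1,q_1}\}\cup\{d_{2,1},\dots,d_{2,q_2}\}\cup\dots\cup\{d_{n-1,1},\dots,d_{n-1,q_{n-1}}\},$$ where each $\{d_{i,1},\dots,d_{i,q_i}\}$ is a finite arithmetic progression determined by: - $d_{1,1}=1$ and $d_{1,j}-d_{1,j-1}=1$ for $2\le j\le q_1$; - $d_{2,1}=d_{1,q_1}+1$ and $d_{2,j}-d_{2,j-1}=d_{1,q_1}$ for $2\le j\le q_2$ (if $n-1\ge 2$); - $d_{i,1}=d_{i-1,q_{i-1}}+d_{i-2,q_{i-2}}$ and $d_{i,j}-d_{i,j-1}=d_{i-1,q_{i-1}}$ for $2\le j\le q_i$, for every $3\le i\le n-1$. Moreover $d_{n-1,q_{n-1}}=p$, and $p$ is the largest sifted degree of $I$; consequently $\mathrm{st}(I)=q_1+\dots+q_{n-1}$ and $\mathrm{rt}(I)=p$.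 -/

import Mathlib

/-! # Effective relations, sifted degrees, sifted type and relation type of an ideal -/

noncomputable section

namespace SiftedDegrees

variable {A : Type*} [CommRing A] (I : Ideal A)

/-- The embedding of `I` as the degree-one piece `I t` of the Rees algebra `⨁ Iⁿ tⁿ ⊆ A[t]`. -/
def degreeOne : I →ₗ[A] reesAlgebra I where
  toFun x := ⟨Polynomial.monomial 1 (x : A), reesAlgebra.monomial_mem.mpr (by simp)⟩
  map_add' x y := by
    apply Subtype.ext
    simp
  map_smul' c x := by
    apply Subtype.ext
    simp [Polynomial.smul_monomial]

/-- The canonical morphism `α : S(I) → R(I)` from the symmetric algebra of the `A`-module `I` to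
the Rees algebra of `I`, extending `x ↦ x t`. -/
def alpha : SymmetricAlgebra A I →ₐ[A] reesAlgebra I :=
  SymmetricAlgebra.lift (degreeOne I)

/-- The `n`-th graded component `S_n(I)` of the symmetric algebra of `I`: the `A`-submodule
spanned by the products of `n` elements of `I` (for `n = 0`, the image of `A`). -/
def symComponent (n : ℕ) : Submodule A (SymmetricAlgebra A I) :=
  LinearMap.range (SymmetricAlgebra.ι A I) ^ n

/-- The kernel of `α_n : S_n(I) → Iⁿ`, the `n`-th graded component of `α`, as an `A`-submodule
of the symmetric algebra. -/
def relations (n : ℕ) : Submodule A (SymmetricAlgebra A I) :=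
  symComponent I n ⊓ LinearMap.ker (alpha I).toLinearMap

/-- `S₁(I) · ker α_m` is contained in `ker α_{m+1}`. -/
theorem symComponent_one_mul_relations_le (m : ℕ) :
    symComponent I 1 * relations I m ≤ relations I (m + 1) := by
  refine Submodule.mul_le.mpr fun x hx y hy => ⟨?_, ?_⟩
  · have h := Submodule.mul_mem_mul hx hy.1
    rwa [symComponent, symComponent, ← pow_add, add_comm 1 m] at h
  · have hy2 : alpha I y = 0 := hy.2
    simp [hy2]

/-- The module of effective `n`-relations `E(I)_n = ker α_n / (S₁(I) · ker α_{n-1})`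
(meaningful for `n ≥ 2`). -/
abbrev EffectiveRelations (n : ℕ) : Type _ :=
  relations I n ⧸ (symComponent I 1 * relations I (n - 1)).submoduleOf (relations I n)

/-- The set `SD(I) = {1} ∪ {n ≥ 2 | E(I)_n ≠ 0}` of sifted degrees of `I`. -/
def siftedDegrees : Set ℕ :=
  {1} ∪ {n | 2 ≤ n ∧ Nontrivial (EffectiveRelations I n)}

/-- The sifted type `st(I)`: the number of sifted degrees. -/
def siftedType : ℕ :=
  (siftedDegrees I).ncard

/-- The relation type `rt(I) = min {r ≥ 1 | E(I)_n = 0 for all n ≥ r + 1}`. -/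
def relationType : ℕ :=
  sInf {r | 1 ≤ r ∧ ∀ n, r + 1 ≤ n → Subsingleton (EffectiveRelations I n)}

end SiftedDegrees

end

/-! Put p = u + v, write x, y for the variables and X, Y, Z for the classes of xᵖ, yᵖ, xᵘyᵛ in
S₁(I). As α sends terms to terms, ker α_n is controlled by differences of terms with equal image. If
the two terms share X, Y or Z, the difference lies in S₁ · ker α_{n-1}; otherwise one looks for a
third term sharing a factor with each. The only obstruction occurs between Zⁿ and XᵃYᵇ, with
coefficients in x, y. Trading d < n copies of Z for X's and Y's costs x to the power (d v mod p),
or, symmetrically, y to the power (d u mod p). So n ≥ 2 is a sifted degree exactly when n v mod p,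
or n u mod p, is smaller than the residues of all smaller positive multiples
(`mem_siftedDegrees_iff`). When there is such a record, the map Z ↦ 1, X, Y ↦ 0 into a truncated
polynomial ring detects the relation xᵉZⁿ - yᵉXᵃYᵇ.

These records are one-sided best approximations. The continuants Q_i of Euclid's algorithm satisfy
Q_i u ≡ ± r_i modulo p, with alternating signs, and the intermediate steps give bases of the lattice
{(n, e) : n u ≡ e mod p}. By `le_of_dvd_of_lt_add` the records are exactly Q_i + j Q_{i+1} with 1 ≤
j ≤ q_{i+1} (`isResidueRecord_iff`). For fixed i these form one progression; the last value is p. -/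

/-! ### Residue records and unimodular pairs -/

/-- `n` is a record for the residues of the multiples of `w` modulo `p`: the residue of `n * w`
is smaller than the residues of all smaller positive multiples. -/
def IsResidueRecord (p : ℕ) (w : ℤ) (n : ℕ) : Prop :=
  ∀ d : ℕ, 0 < d → d < n → ((n : ℤ) * w) % p < ((d : ℤ) * w) % p

/-- The continuants attached to a sequence of partial quotients. -/
def continuant (q : ℕ → ℕ) : ℕ → ℕ
  | 0 => 0
  | 1 => 1
  | i + 2 => continuant q i + q (i + 1) * continuant q (i + 1)

theorem emod_eq_of_dvd_sub {a e p : ℤ} (h0 : 0 ≤ e) (h1 : e < p) (h : p ∣ a - e) : a % p = e := by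
  rw [Int.emod_eq_emod_iff_emod_sub_eq_zero.mpr (Int.emod_eq_zero_of_dvd h),
    Int.emod_eq_of_lt h0 h1]

theorem dvd_sub_emod (a p : ℤ) : p ∣ a - a % p :=
  ⟨a / p, by have := Int.emod_add_mul_ediv a p; linarith⟩

theorem dvd_of_eq_of_dvd {a b c : ℤ} (h : c = b) (hb : a ∣ b) : a ∣ c := h ▸ hb

/-- Best approximation property of a unimodular pair `(d₁, e₁)`, `(d₂, -e₂)` of the lattice of
all `(n, e)` with `n * w ≡ e` modulo `p`. -/
theorem le_of_dvd_of_lt_add {p w d₁ e₁ d₂ e₂ n e : ℤ} (hp : 0 < p) (hd₁ : 0 ≤ d₁) (hd₂ : 0 ≤ d₂)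
    (he₁ : 0 ≤ e₁) (he₂ : 0 < e₂) (hdet : d₁ * e₂ + d₂ * e₁ = p) (h₁ : p ∣ d₁ * w - e₁)
    (h₂ : p ∣ d₂ * w + e₂) (hn : 0 < n) (hlt : n < d₁ + d₂) (h : p ∣ n * w - e) (he : 0 ≤ e) :
    e₁ ≤ e := by
  obtain ⟨m₁, h₁⟩ := h₁
  obtain ⟨m₂, h₂⟩ := h₂
  obtain ⟨m, h⟩ := h
  -- The pair has determinant one, hence is a basis of the lattice; `a` and `b` below are the
  -- coordinates of (n, e) in it.
  have hone : d₁ * m₂ - d₂ * m₁ = 1 := by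
    apply mul_left_cancel₀ hp.ne'
    linear_combination -d₁ * h₂ + d₂ * h₁ + hdet
  obtain ⟨a, ha⟩ : ∃ a, a = n * m₂ - d₂ * m := ⟨_, rfl⟩
  obtain ⟨b, hb⟩ : ∃ b, b = d₁ * m - n * m₁ := ⟨_, rfl⟩
  have hn' : n = a * d₁ + b * d₂ := by
    rw [ha, hb]; linear_combination -n * hone
  have he' : e = a * e₁ - b * e₂ := by
    rw [ha, hb]
    linear_combination -h + (n * m₂ - d₂ * m) * h₁ + (d₁ * m - n * m₁) * h₂
      - (n * w - p * m) * hone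
  -- Both coordinates positive force n ≥ d₁ + d₂, both nonpositive force n ≤ 0, and a ≤ 0 < b forces
  -- e < 0. In the remaining case a ≥ 1, b ≤ 0, so e ≥ e₁.
  rcases le_or_gt 1 a with ha1 | ha1
  · rcases le_or_gt 1 b with hb1 | hb1
    · nlinarith
    · nlinarith
  · rcases le_or_gt 1 b with hb1 | hb1
    · nlinarith
    · nlinarith

/-- The sum of the two basis vectors has residue e₂ - e₁ for -w. Best approximation with the roles
of the vectors exchanged bounds every earlier residue below by e₂, which is larger because e₁ > 0.
-/
theorem isResidueRecord_add {p : ℕ} {w : ℤ} {d₁ e₁ d₂ e₂ : ℕ} (hp : 0 < p) (hd₁ : 0 < d₁)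
    (he₁ : 0 < e₁) (he : e₁ ≤ e₂) (hdet : d₁ * e₂ + d₂ * e₁ = p)
    (h₁ : (p : ℤ) ∣ d₁ * w - e₁) (h₂ : (p : ℤ) ∣ d₂ * w + e₂) :
    IsResidueRecord p (-w) (d₂ + d₁) := by
  intro d hd hdlt
  have hdet' : (d₁ : ℤ) * e₂ + d₂ * e₁ = p := by exact_mod_cast hdet
  have hp' : (0 : ℤ) < p := by exact_mod_cast hp
  have hle : e₂ ≤ p := by nlinarith
  have key : (((d₂ + d₁ : ℕ) : ℤ) * -w) % p = (e₂ : ℤ) - e₁ := by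
    apply emod_eq_of_dvd_sub
    · omega
    · omega
    · exact dvd_of_eq_of_dvd (by push_cast; ring) (dvd_add h₁ h₂).neg_right
  rw [key]
  have := le_of_dvd_of_lt_add (p := p) (w := -w) (d₁ := d₂) (e₁ := e₂) (d₂ := d₁) (e₂ := e₁)
    (n := d) (e := ((d : ℤ) * -w) % p) hp' (by positivity) (by positivity) (by positivity)
    (by exact_mod_cast he₁) (by linarith) (dvd_of_eq_of_dvd (by ring) h₂.neg_right)
    (dvd_of_eq_of_dvd (by ring) h₁.neg_right) (by exact_mod_cast hd)
    (by exact_mod_cast hdlt) (dvd_sub_emod _ _) (Int.emod_nonneg _ hp'.ne')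
  omega

/-- Below d₁ + d₂ nothing beats the basis vectors: d₁ already attains e₁ for w, and d₂ attains e₂
for -w. -/
theorem not_isResidueRecord_of_lt_add {p : ℕ} {w : ℤ} {d₁ e₁ d₂ e₂ n : ℕ} (hp : 0 < p)
    (hd₁ : 0 < d₁) (he₁ : 0 < e₁) (he₁p : e₁ < p) (he₂p : e₂ < p)
    (hdet : d₁ * e₂ + d₂ * e₁ = p)
    (h₁ : (p : ℤ) ∣ d₁ * w - e₁) (h₂ : (p : ℤ) ∣ d₂ * w + e₂) (h12 : d₁ ≤ d₂)
    (hn : d₂ < n) (hlt : n < d₂ + d₁) :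
    ¬ IsResidueRecord p w n ∧ ¬ IsResidueRecord p (-w) n := by
  have hdet' : (d₁ : ℤ) * e₂ + d₂ * e₁ = p := by exact_mod_cast hdet
  have hp' : (0 : ℤ) < p := by exact_mod_cast hp
  constructor
  · intro h
    -- Best approximation needs e₂ > 0; if e₂ = 0, then d₂ has residue 0, which cannot be undercut.
    rcases Nat.eq_zero_or_pos e₂ with h0 | hpos
    · have h3 := h d₂ (by omega) hn
      have : ((d₂ : ℤ) * w) % p = 0 := by
        apply Int.emod_eq_zero_of_dvd; simpa [h0] using h₂
      have := Int.emod_nonneg ((n : ℤ) * w) hp'.ne'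
      omega
    · have h3 := h d₁ hd₁ (by omega)
      rw [emod_eq_of_dvd_sub (e := e₁) (by positivity) (by exact_mod_cast he₁p) h₁] at h3
      have := le_of_dvd_of_lt_add (n := n) (e := ((n : ℤ) * w) % p) hp' (by positivity)
        (by positivity) (by positivity) (by exact_mod_cast hpos) hdet' h₁ h₂
        (by exact_mod_cast (by omega : 0 < n)) (by exact_mod_cast (by omega))
        (dvd_sub_emod _ _) (Int.emod_nonneg _ hp'.ne')
      omega
  · intro h
    have h₁' : (p : ℤ) ∣ d₁ * -w + e₁ := dvd_of_eq_of_dvd (by ring) h₁.neg_right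
    have h₂' : (p : ℤ) ∣ d₂ * -w - e₂ := dvd_of_eq_of_dvd (by ring) h₂.neg_right
    have h3 := h d₂ (by omega) hn
    rw [emod_eq_of_dvd_sub (e := e₂) (by positivity) (by exact_mod_cast he₂p) h₂'] at h3
    have := le_of_dvd_of_lt_add (n := n) (e := ((n : ℤ) * -w) % p) hp' (by positivity)
      (by positivity) (by positivity) (by exact_mod_cast he₁) (by linarith) h₂' h₁'
      (by exact_mod_cast (by omega : 0 < n)) (by exact_mod_cast hlt)
      (dvd_sub_emod _ _) (Int.emod_nonneg _ hp'.ne')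
    omega

/-! ### Continuants of Euclid's algorithm -/

section Euclid

theorem continuant_succ_succ (q : ℕ → ℕ) (i : ℕ) :
    continuant q (i + 2) = continuant q i + q (i + 1) * continuant q (i + 1) := rfl

theorem continuant_det {q r : ℕ → ℕ} {N : ℕ}
    (hdiv : ∀ i < N, r i = q (i + 1) * r (i + 1) + r (i + 2)) (i : ℕ) (hi : i ≤ N) :
    continuant q i * r (i + 1) + continuant q (i + 1) * r i = r 0 := by
  induction i with
  | zero => simp [continuant]
  | succ i ih =>
    rw [← ih (by omega), hdiv i (by omega), continuant_succ_succ]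
    ring

/-- Continuants and sign-alternated remainders obey the same two-term recursion; two consecutive
congruences are carried so that the induction closes. -/
theorem dvd_continuant_mul {q r : ℕ → ℕ} {N : ℕ}
    (hdiv : ∀ i < N, r i = q (i + 1) * r (i + 1) + r (i + 2)) (i : ℕ) (hi : i ≤ N) :
    ((r 0 : ℤ) ∣ continuant q i * r 1 + (-1) ^ i * r i) ∧
      ((r 0 : ℤ) ∣ continuant q (i + 1) * r 1 + (-1) ^ (i + 1) * r (i + 1)) := by
  induction i with
  | zero => simp [continuant]
  | succ i ih =>
    obtain ⟨h₁, h₂⟩ := ih (by omega)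
    refine ⟨h₂, ?_⟩
    refine dvd_of_eq_of_dvd ?_ (dvd_add h₁ (h₂.mul_left (q (i + 1))))
    rw [continuant_succ_succ, hdiv i (by omega)]
    push_cast
    ring

variable {q r : ℕ → ℕ} {N : ℕ}

theorem quotient_pos
    (hdiv : ∀ i < N, r i = q (i + 1) * r (i + 1) + r (i + 2))
    (hdecr : ∀ i ≤ N, r (i + 1) < r i)
    (i : ℕ) (hi : i < N) : 0 < q (i + 1) := by
  have h₁ := hdiv i hi
  have h₂ := hdecr i hi.le
  have h₃ : r (i + 2) < r (i + 1) := hdecr (i + 1) (by omega)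
  rcases Nat.eq_zero_or_pos (q (i + 1)) with h | h
  · rw [h, zero_mul, zero_add] at h₁
    omega
  · exact h

theorem continuant_pos
    (hdiv : ∀ i < N, r i = q (i + 1) * r (i + 1) + r (i + 2))
    (hdecr : ∀ i ≤ N, r (i + 1) < r i)
    (i : ℕ) (hi : i ≤ N) : 0 < continuant q (i + 1) := by
  induction i with
  | zero => simp [continuant]
  | succ i ih =>
    rw [continuant_succ_succ]
    have := Nat.mul_pos (quotient_pos hdiv hdecr i (by omega)) (ih (by omega))
    omega

theorem remainder_pos
    (hdecr : ∀ i ≤ N, r (i + 1) < r i)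
    (i : ℕ) (hi : i ≤ N) : 0 < r i := (Nat.zero_le _).trans_lt (hdecr i hi)

theorem remainder_lt
    (hdecr : ∀ i ≤ N, r (i + 1) < r i)
    (i : ℕ) (hi : i ≤ N) : r (i + 1) < r 0 := by
  induction i with
  | zero => exact hdecr 0 hi
  | succ i ih => exact (hdecr (i + 1) hi).trans (ih (by omega))

/-- Once the remainder vanishes, the determinant identity makes the continuant divide `r 0`, and the
congruence with coprimality gives the converse divisibility. -/
theorem continuant_last
    (hdiv : ∀ i < N, r i = q (i + 1) * r (i + 1) + r (i + 2))
    (hcop : (r 1).Coprime (r 0)) (hr : r (N + 1) = 0) :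
    continuant q (N + 1) = r 0 := by
  have hdet := continuant_det hdiv N le_rfl
  rw [hr, mul_zero, zero_add] at hdet
  have h := (dvd_continuant_mul hdiv N le_rfl).2
  rw [hr] at h
  have h' : r 0 ∣ continuant q (N + 1) * r 1 := by
    have : (r 0 : ℤ) ∣ ((continuant q (N + 1) * r 1 : ℕ) : ℤ) := by simpa using h
    exact_mod_cast this
  exact Nat.dvd_antisymm (hdet ▸ Dvd.intro _ rfl) (hcop.symm.dvd_of_dvd_mul_right h')

/-- The unimodular pair attached to an intermediate step of Euclid's algorithm. -/
theorem intermediate_step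
    (hdiv : ∀ i < N, r i = q (i + 1) * r (i + 1) + r (i + 2))
    (i j : ℕ) (hi : i < N) (hj : j ≤ q (i + 1)) :
    j * r (i + 1) ≤ r i ∧
    continuant q (i + 1) * (r i - j * r (i + 1)) +
      (continuant q i + j * continuant q (i + 1)) * r (i + 1) = r 0 ∧
    ((r 0 : ℤ) ∣ continuant q (i + 1) * ((-1) ^ i * r 1) - r (i + 1)) ∧
    ((r 0 : ℤ) ∣ ((continuant q i + j * continuant q (i + 1) : ℕ) : ℤ) * ((-1) ^ i * r 1) +
      ((r i - j * r (i + 1) : ℕ) : ℤ)) := by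
  have hle : j * r (i + 1) ≤ r i := by
    have := Nat.mul_le_mul_right (r (i + 1)) hj
    have := hdiv i hi
    omega
  obtain ⟨h₁, h₂⟩ := dvd_continuant_mul hdiv i hi.le
  have hs : ((-1 : ℤ) ^ i) * (-1) ^ i = 1 := by rw [← mul_pow]; simp
  have h₂' : (r 0 : ℤ) ∣ continuant q (i + 1) * ((-1) ^ i * r 1) - r (i + 1) := by
    refine dvd_of_eq_of_dvd ?_ (h₂.mul_left ((-1) ^ i))
    rw [pow_succ]
    linear_combination (r (i + 1) : ℤ) * hs
  refine ⟨hle, ?_, h₂', ?_⟩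
  · rw [← continuant_det hdiv i hi.le]
    zify [hle]
    ring
  · refine dvd_of_eq_of_dvd ?_ (dvd_add (h₁.mul_left ((-1) ^ i)) (h₂'.mul_left j))
    push_cast [Nat.cast_sub hle]
    linear_combination -(r i : ℤ) * hs

/-- The numbers `continuant q i + j * continuant q (i + 1)` with `i < N` and `1 ≤ j ≤ q (i + 1)`
are records. -/
theorem isResidueRecord_intermediate
    (hdiv : ∀ i < N, r i = q (i + 1) * r (i + 1) + r (i + 2))
    (hdecr : ∀ i ≤ N, r (i + 1) < r i)
    (i j : ℕ) (hi : i < N) (hj1 : 1 ≤ j)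
    (hj : j ≤ q (i + 1)) :
    IsResidueRecord (r 0) (r 1) (continuant q i + j * continuant q (i + 1)) ∨
      IsResidueRecord (r 0) (-r 1) (continuant q i + j * continuant q (i + 1)) := by
  -- The record of index j + 1 is the sum of the two vectors of the pair of index j; the inequality
  -- e₁ ≤ e₂ needed there is that r i - (j + 1) r (i + 1) is still nonnegative.
  obtain ⟨j, rfl⟩ : ∃ j', j = j' + 1 := ⟨j - 1, by omega⟩
  obtain ⟨-, hdet, h₁, h₂⟩ := intermediate_step hdiv i j hi (by omega)
  obtain ⟨hle, -⟩ := intermediate_step hdiv i (j + 1) hi hj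
  have hrec := isResidueRecord_add (remainder_pos hdecr 0 (by omega))
    (continuant_pos hdiv hdecr i hi.le) (remainder_pos hdecr (i + 1) hi)
    (by rw [add_mul] at hle; omega) hdet h₁ h₂
  rw [add_mul, one_mul, ← add_assoc]
  rcases neg_one_pow_eq_or ℤ i with h | h <;> rw [h] at hrec
  · right; simpa using hrec
  · left; simpa using hrec

/-- The interval from Q_i + Q_{i+1} to Q_{i+1} + Q_{i+2} is cut into pieces of length Q_{i+1}. Their
left ends are the intermediate values, and their interiors contain no record. -/
theorem exists_of_isResidueRecord_of_lt
    (hdiv : ∀ i < N, r i = q (i + 1) * r (i + 1) + r (i + 2))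
    (hdecr : ∀ i ≤ N, r (i + 1) < r i)
    (i : ℕ) (hi : i ≤ N) (n : ℕ) (hn : 0 < n)
    (hnr : n ≤ r 0) (hlt : n < continuant q i + continuant q (i + 1))
    (hrec : IsResidueRecord (r 0) (r 1) n ∨ IsResidueRecord (r 0) (-r 1) n) :
    ∃ i' < i, ∃ j, 1 ≤ j ∧ j ≤ q (i' + 1) ∧
      n = continuant q i' + j * continuant q (i' + 1) := by
  induction i with
  | zero => simp [continuant] at hlt; omega
  | succ i ih =>
    rcases lt_or_ge n (continuant q i + continuant q (i + 1)) with h | h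
    · obtain ⟨i', hi', h'⟩ := ih (by omega) h
      exact ⟨i', by omega, h'⟩
    have hQ := continuant_pos hdiv hdecr i (by omega)
    obtain ⟨m, rfl⟩ := Nat.exists_eq_add_of_le h
    rw [continuant_succ_succ] at hlt
    obtain ⟨P, hP⟩ : ∃ P, P = continuant q i := ⟨_, rfl⟩
    obtain ⟨Q, hQ'⟩ : ∃ Q, Q = continuant q (i + 1) := ⟨_, rfl⟩
    rw [← hP, ← hQ'] at hlt
    rw [← hQ'] at hQ
    obtain ⟨j, s, hs, hm⟩ : ∃ j s, s < Q ∧ m = j * Q + s :=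
      ⟨m / Q, m % Q, Nat.mod_lt _ hQ, (Nat.div_add_mod' m Q).symm⟩
    have hj : j + 1 ≤ q (i + 1) := by
      have : j * Q < q (i + 1) * Q := by omega
      exact Nat.lt_of_mul_lt_mul_right this
    rcases Nat.eq_zero_or_pos s with h0 | hspos
    · exact ⟨i, by omega, j + 1, by omega, hj, by rw [hm, h0, ← hP, ← hQ']; ring⟩
    obtain ⟨hle, hdet, h₁, h₂⟩ := intermediate_step hdiv i (j + 1) (by omega) hj
    rw [← hP, ← hQ'] at hdet h₂ hrec
    rw [← hQ'] at h₁
    have hpos := remainder_pos hdecr (i + 1) hi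
    have hri : r i ≤ r 0 := by
      rcases i with _ | i
      · exact le_rfl
      · exact (remainder_lt hdecr i (by omega)).le
    have hmul : 0 < (j + 1) * r (i + 1) := by positivity
    have hdef : (j + 1) * Q = j * Q + Q := by ring
    have := not_isResidueRecord_of_lt_add (n := P + Q + m) (remainder_pos hdecr 0 (by omega))
      hQ hpos (remainder_lt hdecr i (by omega)) (by omega) hdet h₁ h₂ (by omega)
      (by omega) (by omega)
    exfalso
    rcases neg_one_pow_eq_or ℤ i with h | h <;> rw [h] at this <;>
      simp only [one_mul, neg_mul, neg_neg] at this <;> tauto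

theorem isResidueRecord_iff
    (hdiv : ∀ i < N, r i = q (i + 1) * r (i + 1) + r (i + 2))
    (hdecr : ∀ i ≤ N, r (i + 1) < r i)
    (hN : 0 < N) (hcop : (r 1).Coprime (r 0)) (hr : r (N + 1) = 0)
    (n : ℕ) (hn : 0 < n) :
    (IsResidueRecord (r 0) (r 1) n ∨ IsResidueRecord (r 0) (-r 1) n) ↔
    ∃ i < N, ∃ j, 1 ≤ j ∧ j ≤ q (i + 1) ∧ n = continuant q i + j * continuant q (i + 1) := by
  constructor
  · intro h
    have h0 := remainder_pos hdecr 0 (by omega)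
    -- The multiple of index `r 0` has residue 0, so no record lies beyond it.
    have hnr : n ≤ r 0 := by
      by_contra! hlt
      have hz : ∀ w : ℤ, ¬ IsResidueRecord (r 0) w n := by
        intro w hw
        have h₁ := hw (r 0) h0 hlt
        have h₂ := Int.emod_nonneg ((n : ℤ) * w) (b := r 0) (by omega)
        simp at h₁
        omega
      exact h.elim (hz _) (hz _)
    refine exists_of_isResidueRecord_of_lt hdiv hdecr N le_rfl n hn hnr ?_ h
    obtain ⟨M, rfl⟩ : ∃ M, N = M + 1 := ⟨N - 1, by omega⟩
    have := continuant_pos hdiv hdecr M (by omega)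
    have := continuant_last hdiv hcop hr
    omega
  · rintro ⟨i, hi, j, hj1, hj, rfl⟩
    exact isResidueRecord_intermediate hdiv hdecr i j hi hj1 hj

theorem continuant_le
    (hdiv : ∀ i < N, r i = q (i + 1) * r (i + 1) + r (i + 2))
    (hdecr : ∀ i ≤ N, r (i + 1) < r i)
    (i i' : ℕ) (hi : i ≤ i') (hi' : i' ≤ N) :
    continuant q (i + 1) ≤ continuant q (i' + 1) := by
  induction i', hi using Nat.le_induction with
  | base => exact le_rfl
  | succ m hm ih =>
    refine (ih (by omega)).trans ?_
    rw [continuant_succ_succ]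
    have := Nat.mul_le_mul_right (continuant q (m + 1)) (quotient_pos hdiv hdecr m (by omega))
    omega

theorem card_intermediate
    (hdiv : ∀ i < N, r i = q (i + 1) * r (i + 1) + r (i + 2))
    (hdecr : ∀ i ≤ N, r (i + 1) < r i)
    (d : ℕ → ℕ → ℕ)
    (hd : ∀ i < N, ∀ j, d (i + 1) j = continuant q i + j * continuant q (i + 1)) :
    ((Finset.Icc 1 N).biUnion fun i => (Finset.Icc 1 (q i)).image (d i)).card =
      ∑ i ∈ Finset.Icc 1 N, q i := by
  rw [Finset.card_biUnion]
  · refine Finset.sum_congr rfl fun i hi => ?_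
    obtain ⟨i, rfl⟩ : ∃ i', i = i' + 1 := ⟨i - 1, by have := (Finset.mem_Icc.mp hi).1; omega⟩
    have hi : i < N := (Finset.mem_Icc.mp hi).2
    rw [Finset.card_image_of_injective, Nat.card_Icc, Nat.add_sub_cancel]
    intro j j' h
    simp only [hd i hi] at h
    exact Nat.eq_of_mul_eq_mul_right (continuant_pos hdiv hdecr i hi.le) (by omega)
  · have key : ∀ i i' j j', i < i' → i' < N → 1 ≤ j' → j ≤ q (i + 1) →
        d (i + 1) j ≠ d (i' + 1) j' := by
      intro i i' j j' h hi' hj' hj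
      rw [hd i (by omega), hd i' hi']
      obtain ⟨m, rfl⟩ : ∃ m, i' = m + 1 := ⟨i' - 1, by omega⟩
      have h₁ := continuant_pos hdiv hdecr m (by omega)
      have h₂ := continuant_le hdiv hdecr (i + 1) (m + 1) h hi'.le
      rw [continuant_succ_succ] at h₂
      have h₃ := Nat.mul_le_mul_right (continuant q (i + 1)) hj
      have h₄ := Nat.mul_le_mul_right (continuant q (m + 1 + 1)) hj'
      omega
    intro i hi i' hi' hne
    rw [Function.onFun, Finset.disjoint_left]
    intro x hx hx'
    simp only [Finset.coe_Icc, Set.mem_Icc, Finset.mem_image, Finset.mem_Icc] at hi hi' hx hx'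
    obtain ⟨j, hj, rfl⟩ := hx
    obtain ⟨j', hj', h⟩ := hx'
    obtain ⟨i, rfl⟩ : ∃ m, i = m + 1 := ⟨i - 1, by omega⟩
    obtain ⟨i', rfl⟩ : ∃ m, i' = m + 1 := ⟨i' - 1, by omega⟩
    rcases lt_or_gt_of_ne hne with hlt | hlt
    · exact key i i' j j' (by omega) (by omega) hj'.1 hj.2 h.symm
    · exact key i' i j' j (by omega) (by omega) hj.1 hj'.2 h

end Euclid

/-! ### Terms in the symmetric algebra and their images under α -/

namespace SiftedDegrees

theorem nontrivial_effectiveRelations_iff {A : Type*} [CommRing A] (I : Ideal A) (n : ℕ) :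
    Nontrivial (EffectiveRelations I n) ↔
      ¬ relations I n ≤ symComponent I 1 * relations I (n - 1) := by
  rw [Submodule.Quotient.nontrivial_iff, Ne, Submodule.submoduleOf_eq_top]

noncomputable section

open MvPolynomial

variable {k : Type*} [Field k]

/-- Lets a map be prescribed on terms xˢyᵗ. Only k-linearity is available, since the prescribed
values need not be compatible with multiplication by the variables. -/
theorem exists_addMonoidHom_monomials {i j : Fin 2} (hij : i ≠ j) {M : Type*} [AddCommGroup M]
    [Module (MvPolynomial (Fin 2) k) M] (f : ℕ → ℕ → M) :
    ∃ L : MvPolynomial (Fin 2) k →+ M, ∀ (c : k) (s t : ℕ),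
      L (C c * (X i ^ s * X j ^ t)) = (C c : MvPolynomial (Fin 2) k) • f s t := by
  let _ : Module k M := Module.compHom M (C : k →+* MvPolynomial (Fin 2) k)
  refine ⟨((basisMonomials (Fin 2) k).constr k fun m => f (m i) (m j)).toAddMonoidHom, ?_⟩
  intro c s t
  have h : (C c * (X i ^ s * X j ^ t) : MvPolynomial (Fin 2) k) =
      c • basisMonomials (Fin 2) k (Finsupp.single i s + Finsupp.single j t) := by
    rw [coe_basisMonomials, smul_eq_C_mul, X_pow_eq_monomial, X_pow_eq_monomial, monomial_mul,
      one_mul]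
  rw [h, LinearMap.toAddMonoidHom_coe, map_smul, Module.Basis.constr_basis]
  simp [hij, hij.symm]
  rfl

theorem eq_C_mul_X_pow {i j : Fin 2} (hij : i ≠ j) (m : Fin 2 →₀ ℕ) (c : k) :
    monomial m c = C c * (X i ^ m i * X j ^ m j) := by
  rw [X_pow_eq_monomial, X_pow_eq_monomial, monomial_mul, C_mul_monomial]
  congr 2
  · ext l
    have : l = i ∨ l = j := by omega
    rcases this with rfl | rfl <;> simp [hij, hij.symm]
  · simp

variable (k) in
/-- The ideal generated by `xᵖ`, `yᵖ`, `xᵘ yᵛ` with `p = u + v`, where `x` and `y` are the variables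
with indices `i` and `j`. -/
def threeGenIdeal (i j : Fin 2) (u v : ℕ) : Ideal (MvPolynomial (Fin 2) k) :=
  Ideal.span {X i ^ (u + v), X j ^ (u + v), X i ^ u * X j ^ v}

theorem threeGenIdeal_symm (i j : Fin 2) (u v : ℕ) :
    threeGenIdeal k i j u v = threeGenIdeal k j i v u := by
  rw [threeGenIdeal, threeGenIdeal, Set.insert_comm, add_comm v u, mul_comm (X j ^ v)]

variable (i j : Fin 2) (u v : ℕ)

/-- The three generators of `threeGenIdeal`. -/
def gen (l : Fin 3) : threeGenIdeal k i j u v :=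
  match l with
  | 0 => ⟨X i ^ (u + v), Ideal.subset_span (by simp)⟩
  | 1 => ⟨X j ^ (u + v), Ideal.subset_span (by simp)⟩
  | 2 => ⟨X i ^ u * X j ^ v, Ideal.subset_span (by simp)⟩

variable (k) in
/-- The monomial `xᵃ yᵇ zᶜ` in the images of the three generators in the symmetric algebra. -/
def symMonomial (a b c : ℕ) :
    SymmetricAlgebra (MvPolynomial (Fin 2) k) (threeGenIdeal k i j u v) :=
  SymmetricAlgebra.ι (MvPolynomial (Fin 2) k) (threeGenIdeal k i j u v) (gen i j u v 0) ^ a *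
  SymmetricAlgebra.ι (MvPolynomial (Fin 2) k) (threeGenIdeal k i j u v) (gen i j u v 1) ^ b *
  SymmetricAlgebra.ι (MvPolynomial (Fin 2) k) (threeGenIdeal k i j u v) (gen i j u v 2) ^ c

theorem exists_eq_combination_gen (g : threeGenIdeal k i j u v) :
    ∃ F G H : MvPolynomial (Fin 2) k,
      g = F • gen i j u v 0 + G • gen i j u v 1 + H • gen i j u v 2 := by
  obtain ⟨g, hg⟩ := g
  rw [threeGenIdeal, Ideal.mem_span_insert] at hg
  obtain ⟨F, z, hz, rfl⟩ := hg
  obtain ⟨G, H, rfl⟩ := Ideal.mem_span_pair.mp hz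
  exact ⟨F, G, H, Subtype.ext (by simp [gen, add_assoc])⟩

theorem symComponent_le_span (n : ℕ) :
    symComponent (threeGenIdeal k i j u v) n ≤ Submodule.span (MvPolynomial (Fin 2) k)
      {x | ∃ a b c, a + b + c = n ∧ x = symMonomial k i j u v a b c} := by
  induction n with
  | zero =>
    rw [symComponent, pow_zero, Submodule.one_eq_span]
    exact Submodule.span_mono (by
      rintro _ rfl; exact ⟨0, 0, 0, rfl, by simp [symMonomial]⟩)
  | succ n ih =>
    rw [symComponent, pow_succ]
    have hι : LinearMap.range (SymmetricAlgebra.ι (MvPolynomial (Fin 2) k)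
        (threeGenIdeal k i j u v)) ≤ Submodule.span _
          (Set.range fun l => SymmetricAlgebra.ι (MvPolynomial (Fin 2) k)
            (threeGenIdeal k i j u v) (gen i j u v l)) := by
      rintro _ ⟨g, rfl⟩
      obtain ⟨F, G, H, rfl⟩ := exists_eq_combination_gen i j u v g
      simp only [map_add, map_smul]
      exact add_mem (add_mem (Submodule.smul_mem _ _ (Submodule.subset_span ⟨0, rfl⟩))
        (Submodule.smul_mem _ _ (Submodule.subset_span ⟨1, rfl⟩)))
        (Submodule.smul_mem _ _ (Submodule.subset_span ⟨2, rfl⟩))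
    refine (mul_le_mul' ih hι).trans ?_
    rw [Submodule.span_mul_span]
    refine Submodule.span_mono ?_
    rintro _ ⟨_, ⟨a, b, c, h, rfl⟩, _, ⟨l, rfl⟩, rfl⟩
    obtain rfl | rfl | rfl : l = 0 ∨ l = 1 ∨ l = 2 := by omega
    · exact ⟨a + 1, b, c, by omega, by simp only [symMonomial]; ring⟩
    · exact ⟨a, b + 1, c, by omega, by simp only [symMonomial]; ring⟩
    · exact ⟨a, b, c + 1, by omega, by simp only [symMonomial]; ring⟩

theorem symMonomial_mem (a b c : ℕ) :
    symMonomial k i j u v a b c ∈ symComponent (threeGenIdeal k i j u v) (a + b + c) := by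
  rw [symComponent, pow_add, pow_add]
  exact Submodule.mul_mem_mul (Submodule.mul_mem_mul
    (Submodule.pow_mem_pow _ (LinearMap.mem_range_self _ _) _) (Submodule.pow_mem_pow _ (LinearMap.mem_range_self _ _) _))
    (Submodule.pow_mem_pow _ (LinearMap.mem_range_self _ _) _)

theorem alpha_symMonomial (a b c : ℕ) :
    (alpha (threeGenIdeal k i j u v) (symMonomial k i j u v a b c) :
      Polynomial (MvPolynomial (Fin 2) k)) =
      Polynomial.monomial (a + b + c)
        (X i ^ ((u + v) * a + u * c) * X j ^ ((u + v) * b + v * c)) := by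
  simp only [symMonomial, map_mul, map_pow, alpha, SymmetricAlgebra.lift_ι_apply]
  simp only [degreeOne, LinearMap.coe_mk, AddHom.coe_mk, gen, MulMemClass.coe_mul,
    SubmonoidClass.coe_pow, Polynomial.monomial_pow, Polynomial.monomial_mul_monomial, one_mul]
  congr 1
  ring

/-- The `n`-th component of `alpha`, with values in `A`. -/
def coeffAlpha {A : Type*} [CommRing A] (I : Ideal A) (n : ℕ) : SymmetricAlgebra A I →ₗ[A] A :=
  Polynomial.lcoeff A n ∘ₗ (reesAlgebra I).val.toLinearMap ∘ₗ (alpha I).toLinearMap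

theorem coeffAlpha_eq_zero {A : Type*} [CommRing A] (I : Ideal A) (n m : ℕ)
    {x : SymmetricAlgebra A I} (hx : x ∈ relations I m) : coeffAlpha I n x = 0 := by
  have : alpha I x = 0 := hx.2
  simp [coeffAlpha, this]

theorem coeffAlpha_smul_symMonomial (g : MvPolynomial (Fin 2) k) {a b c n : ℕ}
    (h : a + b + c = n) :
    coeffAlpha (threeGenIdeal k i j u v) n (g • symMonomial k i j u v a b c) =
      g * (X i ^ ((u + v) * a + u * c) * X j ^ ((u + v) * b + v * c)) := by
  subst h
  rw [map_smul, smul_eq_mul]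
  congr 1
  simp [coeffAlpha, alpha_symMonomial]

/-- Used to show that a map on S_n factors through `coeffAlpha`, and so kills the relations, by
checking terms only. -/
theorem addMonoidHom_eq_of_mem_symComponent {i j : Fin 2} (hij : i ≠ j) {u v : ℕ}
    {M : Type*} [AddCommGroup M]
    {F G : SymmetricAlgebra (MvPolynomial (Fin 2) k) (threeGenIdeal k i j u v) →+ M} {n : ℕ}
    (h : ∀ (r : k) (s t a b c : ℕ), a + b + c = n →
      F ((C r * (X i ^ s * X j ^ t) : MvPolynomial (Fin 2) k) • symMonomial k i j u v a b c) =
      G ((C r * (X i ^ s * X j ^ t) : MvPolynomial (Fin 2) k) • symMonomial k i j u v a b c))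
    {x : SymmetricAlgebra (MvPolynomial (Fin 2) k) (threeGenIdeal k i j u v)}
    (hx : x ∈ symComponent (threeGenIdeal k i j u v) n) : F x = G x := by
  replace hx := symComponent_le_span i j u v n hx
  -- F and G are only additive, so the claim is strengthened to all multiples of x to survive the
  -- scalar step of the span induction.
  suffices ∀ g : MvPolynomial (Fin 2) k, F (g • x) = G (g • x) by simpa using this 1
  induction hx using Submodule.span_induction with
  | mem x hx =>
    obtain ⟨a, b, c, habc, rfl⟩ := hx
    intro g
    induction g using MvPolynomial.induction_on' with
    | monomial m r => rw [eq_C_mul_X_pow hij]; exact h _ _ _ _ _ _ habc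
    | add p q hp hq => rw [add_smul, map_add, map_add, hp, hq]
  | zero => simp
  | add x y _ _ ihx ihy => intro g; rw [smul_add, map_add, map_add, ihx, ihy]
  | smul r x _ ihx => intro g; rw [smul_smul]; exact ihx _

end

end SiftedDegrees

/-! ### Degrees that are not records: linking terms -/

namespace SiftedDegrees

noncomputable section

open MvPolynomial

variable {k : Type*} [Field k] {i j : Fin 2} {u v : ℕ}

variable (k i j u v) in
/-- The monomials `xˢ yᵗ Xᵃ Yᵇ Zᶜ` spanning the symmetric algebra. -/
def fullMonomial (s t a b c : ℕ) :
    SymmetricAlgebra (MvPolynomial (Fin 2) k) (threeGenIdeal k i j u v) :=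
  (X i ^ s * X j ^ t : MvPolynomial (Fin 2) k) • symMonomial k i j u v a b c

theorem fullMonomial_sub_mem_relations {n s t a b c s' t' a' b' c' : ℕ}
    (h : a + b + c = n) (h' : a' + b' + c' = n)
    (h₁ : s + (u + v) * a + u * c = s' + (u + v) * a' + u * c')
    (h₂ : t + (u + v) * b + v * c = t' + (u + v) * b' + v * c') :
    fullMonomial k i j u v s t a b c - fullMonomial k i j u v s' t' a' b' c' ∈
      relations (threeGenIdeal k i j u v) n := by
  refine ⟨sub_mem (Submodule.smul_mem _ _ (h ▸ symMonomial_mem i j u v a b c))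
    (Submodule.smul_mem _ _ (h' ▸ symMonomial_mem i j u v a' b' c')), ?_⟩
  rw [SetLike.mem_coe, LinearMap.mem_ker, AlgHom.toLinearMap_apply, map_sub, sub_eq_zero]
  apply Subtype.ext
  rw [fullMonomial, fullMonomial, map_smul, map_smul, SetLike.val_smul, SetLike.val_smul,
    alpha_symMonomial, alpha_symMonomial, h, h', Polynomial.smul_monomial,
    Polynomial.smul_monomial, smul_eq_mul, smul_eq_mul, mul_mul_mul_comm, ← pow_add, ← pow_add,
    mul_mul_mul_comm, ← pow_add, ← pow_add, ← add_assoc, ← add_assoc, ← add_assoc, ← add_assoc,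
    h₁, h₂]

theorem ι_gen_mem (l : Fin 3) :
    SymmetricAlgebra.ι (MvPolynomial (Fin 2) k) (threeGenIdeal k i j u v) (gen i j u v l) ∈
      symComponent (threeGenIdeal k i j u v) 1 := by
  rw [symComponent, pow_one]
  exact LinearMap.mem_range_self _ _

/-- Cancelling the shared generator leaves a difference of terms with equal image one degree lower.
-/
theorem fullMonomial_sub_mem_of_common {n s t a b c s' t' a' b' c' : ℕ}
    (h : a + b + c = n + 1) (h' : a' + b' + c' = n + 1)
    (h₁ : s + (u + v) * a + u * c = s' + (u + v) * a' + u * c')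
    (h₂ : t + (u + v) * b + v * c = t' + (u + v) * b' + v * c')
    (hc : (0 < a ∧ 0 < a') ∨ (0 < b ∧ 0 < b') ∨ (0 < c ∧ 0 < c')) :
    fullMonomial k i j u v s t a b c - fullMonomial k i j u v s' t' a' b' c' ∈
      symComponent (threeGenIdeal k i j u v) 1 * relations (threeGenIdeal k i j u v) n := by
  rcases hc with ⟨ha, ha'⟩ | ⟨hb, hb'⟩ | ⟨hc, hc'⟩
  · obtain ⟨a, rfl⟩ := Nat.exists_eq_add_one_of_ne_zero ha.ne'
    obtain ⟨a', rfl⟩ := Nat.exists_eq_add_one_of_ne_zero ha'.ne'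
    have := Submodule.mul_mem_mul (ι_gen_mem (k := k) (i := i) (j := j) (u := u) (v := v) 0)
      (fullMonomial_sub_mem_relations (k := k) (i := i) (j := j) (u := u) (v := v)
      (n := n) (s := s) (t := t) (a := a) (b := b) (c := c) (s' := s') (t' := t') (a' := a')
      (b' := b') (c' := c') (by omega) (by omega) (by rw [Nat.mul_add_one, Nat.mul_add_one] at h₁; omega)
      (by omega))
    convert this using 1
    simp only [fullMonomial, symMonomial, mul_sub, mul_smul_comm]
    congr 2 <;> ring
  · obtain ⟨b, rfl⟩ := Nat.exists_eq_add_one_of_ne_zero hb.ne'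
    obtain ⟨b', rfl⟩ := Nat.exists_eq_add_one_of_ne_zero hb'.ne'
    have := Submodule.mul_mem_mul (ι_gen_mem (k := k) (i := i) (j := j) (u := u) (v := v) 1)
      (fullMonomial_sub_mem_relations (k := k) (i := i) (j := j) (u := u) (v := v)
      (n := n) (s := s) (t := t) (a := a) (b := b) (c := c) (s' := s') (t' := t') (a' := a')
      (b' := b') (c' := c') (by omega) (by omega) (by omega)
      (by rw [Nat.mul_add_one, Nat.mul_add_one] at h₂; omega))
    convert this using 1
    simp only [fullMonomial, symMonomial, mul_sub, mul_smul_comm]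
    congr 2 <;> ring
  · obtain ⟨c, rfl⟩ := Nat.exists_eq_add_one_of_ne_zero hc.ne'
    obtain ⟨c', rfl⟩ := Nat.exists_eq_add_one_of_ne_zero hc'.ne'
    have := Submodule.mul_mem_mul (ι_gen_mem (k := k) (i := i) (j := j) (u := u) (v := v) 2)
      (fullMonomial_sub_mem_relations (k := k) (i := i) (j := j) (u := u) (v := v)
      (n := n) (s := s) (t := t) (a := a) (b := b) (c := c) (s' := s') (t' := t') (a' := a')
      (b' := b') (c' := c') (by omega) (by omega) (by rw [Nat.mul_add_one, Nat.mul_add_one] at h₁; omega)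
      (by rw [Nat.mul_add_one, Nat.mul_add_one] at h₂; omega))
    convert this using 1
    simp only [fullMonomial, symMonomial, mul_sub, mul_smul_comm]
    congr 2 <;> ring

/-- Two monomials of the same degree and weight are congruent modulo `S₁ · ker α_n` as soon as a
third one shares a factor with each of them. -/
theorem fullMonomial_sub_mem_of_link {n s t a b c s' t' a' b' c' : ℕ} (s₀ t₀ a₀ b₀ c₀ : ℕ)
    (h : a + b + c = n + 1) (h' : a' + b' + c' = n + 1) (h₀ : a₀ + b₀ + c₀ = n + 1)
    (h₁ : s + (u + v) * a + u * c = s' + (u + v) * a' + u * c')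
    (h₂ : t + (u + v) * b + v * c = t' + (u + v) * b' + v * c')
    (h₃ : s + (u + v) * a + u * c = s₀ + (u + v) * a₀ + u * c₀)
    (h₄ : t + (u + v) * b + v * c = t₀ + (u + v) * b₀ + v * c₀)
    (hc : (0 < a ∧ 0 < a₀) ∨ (0 < b ∧ 0 < b₀) ∨ (0 < c ∧ 0 < c₀))
    (hc' : (0 < a₀ ∧ 0 < a') ∨ (0 < b₀ ∧ 0 < b') ∨ (0 < c₀ ∧ 0 < c')) :
    fullMonomial k i j u v s t a b c - fullMonomial k i j u v s' t' a' b' c' ∈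
      symComponent (threeGenIdeal k i j u v) 1 * relations (threeGenIdeal k i j u v) n := by
  have := add_mem (fullMonomial_sub_mem_of_common (k := k) (i := i) (j := j) h h₀ h₃ h₄ hc)
    (fullMonomial_sub_mem_of_common (k := k) (i := i) (j := j) h₀ h' (h₃ ▸ h₁) (h₄ ▸ h₂) hc')
  simpa using this

/-- Bookkeeping for the trade of x^{e'} Z^d for y^{e'} X^{a₀} Y^{b₀}, with e' = d v mod p. It can be
made inside xᵉ because e ≡ n v modulo p gives e ≥ n v mod p ≥ e'. -/
theorem exists_split_of_residue_le {u v n d e b : ℕ} (hu : 0 < u) (hd : 0 < d)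
    (hle : (d * v) % (u + v) ≤ (n * v) % (u + v)) (he : e + (u + v) * b = n * v) :
    ∃ e' a₀ b₀, e' ≤ e ∧ 0 < a₀ ∧ a₀ + b₀ = d ∧ (u + v) * a₀ = u * d + e' ∧
      (u + v) * b₀ + e' = v * d := by
  have hdiv := Nat.div_add_mod (d * v) (u + v)
  obtain ⟨b₀, hb₀⟩ : ∃ b₀, b₀ = d * v / (u + v) := ⟨_, rfl⟩
  obtain ⟨e', he₀⟩ : ∃ e', e' = d * v % (u + v) := ⟨_, rfl⟩
  rw [← hb₀, ← he₀] at hdiv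
  rw [← he₀] at hle
  have he' : e' ≤ e := by
    refine hle.trans ?_
    rw [← he, Nat.add_mul_mod_self_left]
    exact Nat.mod_le _ _
  have hud : 0 < u * d := Nat.mul_pos hu hd
  have hb : b₀ < d := by
    by_contra! hlt
    have := Nat.mul_le_mul_left (u + v) hlt
    nlinarith
  obtain ⟨a₀, rfl⟩ := Nat.exists_eq_add_of_lt hb
  exact ⟨e', a₀ + 1, b₀, he', by omega, by omega, by nlinarith, by nlinarith⟩

theorem fullMonomial_sub_mem_of_zero_pos {n : ℕ} (hn : 0 < n) (hu : 0 < u) (hv : 0 < v)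
    (hrv : ∃ d, 0 < d ∧ d < n + 1 ∧ (d * v) % (u + v) ≤ ((n + 1) * v) % (u + v))
    (hru : ∃ d, 0 < d ∧ d < n + 1 ∧ (d * u) % (u + v) ≤ ((n + 1) * u) % (u + v))
    {s t a b c s' t' a' b' : ℕ} (hc : 0 < c)
    (h : a + b + c = n + 1) (h' : a' + b' = n + 1)
    (h₁ : s + (u + v) * a + u * c = s' + (u + v) * a')
    (h₂ : t + (u + v) * b + v * c = t' + (u + v) * b') :
    fullMonomial k i j u v s t a b c - fullMonomial k i j u v s' t' a' b' 0 ∈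
      symComponent (threeGenIdeal k i j u v) 1 * relations (threeGenIdeal k i j u v) n := by
  have huc : u ≤ u * c := Nat.le_mul_of_pos_right _ hc
  have hvc : v ≤ v * c := Nat.le_mul_of_pos_right _ hc
  by_cases hcom : (0 < a ∧ 0 < a') ∨ (0 < b ∧ 0 < b')
  · exact fullMonomial_sub_mem_of_common h (by omega) (by simpa using h₁) (by simpa using h₂)
      (by omega)
  rcases Nat.eq_zero_or_pos a with rfl | ha
  · rcases Nat.eq_zero_or_pos b with rfl | hb
    · obtain rfl : c = n + 1 := by omega
      simp only [mul_zero, add_zero] at h₁ h₂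
      have hs : (u + v) * a' + (u + v) * b' = u * (n + 1) + v * (n + 1) := by
        rw [← mul_add, h', add_mul]
      -- Z^{n+1} against X^{a'}Y^{b'}. The sign of p a' - u (n + 1) tells whether x or y can be
      -- spent; d copies of Z are traded, leaving `m + 1` ≥ 1 of them. The link shares Z with the
      -- first term, and X (respectively Y) with the second.
      rcases le_or_gt (u * (n + 1)) ((u + v) * a') with hle | hlt
      · obtain ⟨e, he⟩ := Nat.exists_eq_add_of_le hle
        obtain ⟨d, hd, hdn, hd'⟩ := hrv
        obtain ⟨e', a₀, b₀, hee, ha₀, hab, h3, h4⟩ := exists_split_of_residue_le (e := e) hu hd hd'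
          (b := b') (by rw [mul_comm (n + 1)]; omega)
        have ha' : 0 < a' := by
          rcases Nat.eq_zero_or_pos a' with rfl | h0
          · have := Nat.mul_pos hu n.succ_pos
            simp only [mul_zero, Nat.succ_eq_add_one] at *
            omega
          · exact h0
        obtain ⟨m, hm⟩ := Nat.exists_eq_add_of_lt hdn
        have hum : u * (n + 1) = u * d + u * (m + 1) := by rw [hm]; ring
        have hvm : v * (n + 1) = v * d + v * (m + 1) := by rw [hm]; ring
        exact fullMonomial_sub_mem_of_link (s - e') (t + e') a₀ b₀ (m + 1) (by omega) (by omega)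
          (by omega) (by omega) (by omega) (by omega) (by omega) (by omega) (by omega)
      · obtain ⟨e, he⟩ := Nat.exists_eq_add_of_le hlt.le
        obtain ⟨d, hd, hdn, hd'⟩ := hru
        rw [add_comm u v] at hd'
        obtain ⟨e', b₀, a₀, hee, hb₀, hab, h3, h4⟩ := exists_split_of_residue_le (e := e) hv hd hd'
          (b := a') (by rw [mul_comm (n + 1), add_comm v]; omega)
        rw [add_comm v u] at h3 h4
        have hb' : 0 < b' := by
          rcases Nat.eq_zero_or_pos b' with rfl | h0
          · have := Nat.mul_pos hv n.succ_pos
            simp only [mul_zero, Nat.succ_eq_add_one] at *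
            omega
          · exact h0
        obtain ⟨m, hm⟩ := Nat.exists_eq_add_of_lt hdn
        have hum : u * (n + 1) = u * d + u * (m + 1) := by rw [hm]; ring
        have hvm : v * (n + 1) = v * d + v * (m + 1) := by rw [hm]; ring
        exact fullMonomial_sub_mem_of_link (s + e') (t - e') a₀ b₀ (m + 1) (by omega) (by omega)
          (by omega) (by omega) (by omega) (by omega) (by omega) (by omega) (by omega)
    · obtain ⟨rfl, rfl⟩ : b' = 0 ∧ a' = n + 1 := by omega
      have e1 : (u + v) * (n + 1) = (u + v) * n + u + v := by ring
      have e2 : (u + v) * 1 = u + v := by ring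
      -- The link replaces one X of X^{n+1} by Z, exchanging yᵛ for xᵛ.
      exact fullMonomial_sub_mem_of_link (s' + v) (t' - v) n 0 1 (by omega) (by omega)
        (by omega) (by omega) (by omega) (by omega) (by omega) (by omega) (by omega)
  · obtain ⟨rfl, rfl⟩ : a' = 0 ∧ b' = n + 1 := by omega
    have e1 : (u + v) * (n + 1) = (u + v) * n + u + v := by ring
    exact fullMonomial_sub_mem_of_link (s' - u) (t' + u) 0 n 1 (by omega) (by omega)
      (by omega) (by omega) (by omega) (by omega) (by omega) (by omega) (by omega)

theorem fullMonomial_sub_mem_of_zero_zero {n : ℕ} (hn : 0 < n)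
    {s t a b s' t' a' b' : ℕ}
    (h : a + b = n + 1) (h' : a' + b' = n + 1)
    (h₁ : s + (u + v) * a = s' + (u + v) * a')
    (h₂ : t + (u + v) * b = t' + (u + v) * b') :
    fullMonomial k i j u v s t a b 0 - fullMonomial k i j u v s' t' a' b' 0 ∈
      symComponent (threeGenIdeal k i j u v) 1 * relations (threeGenIdeal k i j u v) n := by
  by_cases hcom : (0 < a ∧ 0 < a') ∨ (0 < b ∧ 0 < b')
  · exact fullMonomial_sub_mem_of_common h (by omega) (by simpa using h₁) (by simpa using h₂)
      (by omega)
  have e1 : (u + v) * (n + 1) = (u + v) * n + (u + v) := by ring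
  rcases Nat.eq_zero_or_pos a with rfl | ha
  · obtain ⟨rfl, rfl, rfl⟩ : b' = 0 ∧ a' = n + 1 ∧ b = n + 1 := by omega
    -- Y^{n+1} and X^{n+1} are linked by XⁿY, which needs n > 0.
    exact fullMonomial_sub_mem_of_link (s' + (u + v)) (t' - (u + v)) n 1 0 (by omega) (by omega)
      (by omega) (by omega) (by omega) (by omega) (by omega) (by omega) (by omega)
  · obtain ⟨rfl, rfl, rfl⟩ : a' = 0 ∧ b' = n + 1 ∧ a = n + 1 := by omega
    exact fullMonomial_sub_mem_of_link (s' - (u + v)) (t' + (u + v)) 1 n 0 (by omega) (by omega)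
      (by omega) (by omega) (by omega) (by omega) (by omega) (by omega) (by omega)

theorem fullMonomial_sub_mem {n : ℕ} (hn : 0 < n) (hu : 0 < u) (hv : 0 < v)
    (hrv : ∃ d, 0 < d ∧ d < n + 1 ∧ (d * v) % (u + v) ≤ ((n + 1) * v) % (u + v))
    (hru : ∃ d, 0 < d ∧ d < n + 1 ∧ (d * u) % (u + v) ≤ ((n + 1) * u) % (u + v))
    {s t a b c s' t' a' b' c' : ℕ}
    (h : a + b + c = n + 1) (h' : a' + b' + c' = n + 1)
    (h₁ : s + (u + v) * a + u * c = s' + (u + v) * a' + u * c')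
    (h₂ : t + (u + v) * b + v * c = t' + (u + v) * b' + v * c') :
    fullMonomial k i j u v s t a b c - fullMonomial k i j u v s' t' a' b' c' ∈
      symComponent (threeGenIdeal k i j u v) 1 * relations (threeGenIdeal k i j u v) n := by
  rcases Nat.eq_zero_or_pos c with rfl | hc <;> rcases Nat.eq_zero_or_pos c' with rfl | hc'
  · exact fullMonomial_sub_mem_of_zero_zero hn h h' h₁ h₂
  · rw [← neg_sub]
    exact neg_mem (fullMonomial_sub_mem_of_zero_pos hn hu hv hrv hru hc' h' h h₁.symm h₂.symm)
  · exact fullMonomial_sub_mem_of_zero_pos hn hu hv hrv hru hc h h' h₁ h₂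
  · exact fullMonomial_sub_mem_of_common h h' h₁ h₂ (Or.inr (Or.inr ⟨hc, hc'⟩))

theorem relations_le_of_not_record {n : ℕ} (hij : i ≠ j) (hn : 0 < n) (hu : 0 < u) (hv : 0 < v)
    (hrv : ∃ d, 0 < d ∧ d < n + 1 ∧ (d * v) % (u + v) ≤ ((n + 1) * v) % (u + v))
    (hru : ∃ d, 0 < d ∧ d < n + 1 ∧ (d * u) % (u + v) ≤ ((n + 1) * u) % (u + v)) :
    relations (threeGenIdeal k i j u v) (n + 1) ≤
      symComponent (threeGenIdeal k i j u v) 1 * relations (threeGenIdeal k i j u v) n := by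
  classical
  intro x hx
  set N := symComponent (threeGenIdeal k i j u v) 1 * relations (threeGenIdeal k i j u v) n
    with hN
  let W (w₁ w₂ : ℕ) (m : ℕ × ℕ × ℕ × ℕ × ℕ) : Prop :=
    m.2.2.1 + m.2.2.2.1 + m.2.2.2.2 = n + 1 ∧
      m.1 + (u + v) * m.2.2.1 + u * m.2.2.2.2 = w₁ ∧
      m.2.1 + (u + v) * m.2.2.2.1 + v * m.2.2.2.2 = w₂
  let toQuot (m : ℕ × ℕ × ℕ × ℕ × ℕ) := N.mkQ
    (fullMonomial k i j u v m.1 m.2.1 m.2.2.1 m.2.2.2.1 m.2.2.2.2)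
  -- `L` sends x^{w₁}y^{w₂} to the class of any term with that image, independent of the choice by
  -- `fullMonomial_sub_mem`. Then `L` after α is the quotient map on S_{n+1}; the value 0 for
  -- unattained weights plays no role.
  obtain ⟨L, hL⟩ := exists_addMonoidHom_monomials (k := k) hij
    fun w₁ w₂ => if h : ∃ m, W w₁ w₂ m then toQuot h.choose else 0
  have hquot : ∀ w₁ w₂ m m', W w₁ w₂ m → W w₁ w₂ m' → toQuot m = toQuot m' := by
    rintro w₁ w₂ m m' ⟨h, h₁, h₂⟩ ⟨h', h₁', h₂'⟩
    exact (Submodule.Quotient.eq N).mpr (fullMonomial_sub_mem hn hu hv hrv hru h h'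
      (h₁.trans h₁'.symm) (h₂.trans h₂'.symm))
  have key := addMonoidHom_eq_of_mem_symComponent hij (F := N.mkQ.toAddMonoidHom)
    (G := L.comp (coeffAlpha (threeGenIdeal k i j u v) (n + 1)).toAddMonoidHom) (n := n + 1)
    (by
      intro r s t a b c habc
      have hW : W (s + (u + v) * a + u * c) (t + (u + v) * b + v * c) (s, t, a, b, c) :=
        ⟨habc, rfl, rfl⟩
      have hex : ∃ m, W (s + (u + v) * a + u * c) (t + (u + v) * b + v * c) m := ⟨_, hW⟩
      rw [AddMonoidHom.comp_apply, LinearMap.toAddMonoidHom_coe, LinearMap.toAddMonoidHom_coe,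
        coeffAlpha_smul_symMonomial _ _ _ _ _ habc, mul_assoc, mul_mul_mul_comm, ← pow_add,
        ← pow_add, hL, ← add_assoc, ← add_assoc, dif_pos hex,
        hquot _ _ _ _ hex.choose_spec hW, mul_smul, map_smul]
      rfl) hx.1
  rw [AddMonoidHom.comp_apply, LinearMap.toAddMonoidHom_coe, LinearMap.toAddMonoidHom_coe,
    coeffAlpha_eq_zero _ _ _ hx, map_zero] at key
  exact (Submodule.Quotient.mk_eq_zero N).mp key

/-! ### Records give effective relations: a test algebra -/

theorem exists_linearMap_comp_eq {R M N P : Type*} [Ring R] [AddCommGroup M] [AddCommGroup N]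
    [AddCommGroup P] [Module R M] [Module R N] [Module R P] (T : M →ₗ[R] N) (f : M →ₗ[R] P)
    (hT : Function.Surjective T) (hker : LinearMap.ker T ≤ LinearMap.ker f) :
    ∃ g : N →ₗ[R] P, ∀ x, g (T x) = f x := by
  refine ⟨(LinearMap.ker T).liftQ f hker ∘ₗ (T.quotKerEquivOfSurjective hT).symm.toLinearMap,
    fun x => ?_⟩
  have : (T.quotKerEquivOfSurjective hT).symm (T x) = Submodule.Quotient.mk x :=
    (LinearEquiv.symm_apply_eq _).mpr rfl
  simp [this]

/-- Unique factorization puts the Z-coefficient of every syzygy in (xᵛ, yᵘ). This makes Z ↦ 1, X, Y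
↦ 0 well defined on I modulo (y, xᵉ⁺¹). -/
theorem mem_of_combination_eq_zero (hij : i ≠ j) {e : ℕ} (hu : 0 < u) (he : e < v)
    {F G H : MvPolynomial (Fin 2) k}
    (h : F * X i ^ (u + v) + G * X j ^ (u + v) + H * (X i ^ u * X j ^ v) = 0) :
    H ∈ Ideal.span {X j, X i ^ (e + 1)} := by
  have hXi : ¬ (X j : MvPolynomial (Fin 2) k) ∣ X i := fun h => hij (X_dvd_X.mp h).symm
  have hXj : ¬ (X i : MvPolynomial (Fin 2) k) ∣ X j := fun h => hij (X_dvd_X.mp h)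
  obtain ⟨F', rfl⟩ : X j ^ v ∣ F := by
    refine (X_prime (i := j)).pow_dvd_of_dvd_mul_right v
      (fun h => hXi ((X_prime (i := j)).dvd_of_dvd_pow h)) (b := X i ^ (u + v)) ?_
    exact ⟨-(G * X j ^ u + H * X i ^ u), by linear_combination h⟩
  obtain ⟨G', rfl⟩ : X i ^ u ∣ G := by
    refine (X_prime (i := i)).pow_dvd_of_dvd_mul_right u
      (fun h => hXj ((X_prime (i := i)).dvd_of_dvd_pow h)) (b := X j ^ (u + v)) ?_
    exact ⟨-(X j ^ v * F' * X i ^ v + H * X j ^ v), by linear_combination h⟩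
  have hH : H = -(F' * X i ^ v + G' * X j ^ u) := by
    have hne : (X i ^ u * X j ^ v : MvPolynomial (Fin 2) k) ≠ 0 :=
      mul_ne_zero (pow_ne_zero _ (X_ne_zero _)) (pow_ne_zero _ (X_ne_zero _))
    apply mul_left_cancel₀ hne
    linear_combination h
  rw [hH]
  refine neg_mem (add_mem (Ideal.mul_mem_left _ _ ?_) (Ideal.mul_mem_left _ _ ?_))
  · exact Ideal.mem_of_dvd _ (pow_dvd_pow _ he) (Ideal.subset_span (by simp))
  · exact Ideal.pow_mem_of_mem _ (Ideal.subset_span (by simp)) _ hu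

variable (k i j) in
/-- The ideal generated by `y` and `xᵉ⁺¹`. -/
def truncIdeal (e : ℕ) : Ideal (MvPolynomial (Fin 2) k) := Ideal.span {X j, X i ^ (e + 1)}

theorem exists_algHom_truncIdeal (hij : i ≠ j) {e : ℕ} (hu : 0 < u) (he : e < v) :
    ∃ β : SymmetricAlgebra (MvPolynomial (Fin 2) k) (threeGenIdeal k i j u v)
        →ₐ[MvPolynomial (Fin 2) k] MvPolynomial (Fin 2) k ⧸ truncIdeal k i j e,
      ∀ a b c, β (symMonomial k i j u v a b c) = if a + b = 0 then 1 else 0 := by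
  let A := MvPolynomial (Fin 2) k
  let T : (A × A × A) →ₗ[A] threeGenIdeal k i j u v :=
    (LinearMap.toSpanSingleton A _ (gen i j u v 0)).coprod
      ((LinearMap.toSpanSingleton A _ (gen i j u v 1)).coprod
        (LinearMap.toSpanSingleton A _ (gen i j u v 2)))
  have hT : ∀ F G H : A, T (F, G, H) =
      F • gen i j u v 0 + G • gen i j u v 1 + H • gen i j u v 2 := by
    intro F G H
    simp [T, add_assoc]
  let f : (A × A × A) →ₗ[A] A ⧸ truncIdeal k i j e :=
    (truncIdeal k i j e).mkQ ∘ₗ LinearMap.snd A A A ∘ₗ LinearMap.snd A A (A × A)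
  obtain ⟨g, hg⟩ := exists_linearMap_comp_eq T f
    (fun x => by
      obtain ⟨F, G, H, h⟩ := exists_eq_combination_gen i j u v x
      exact ⟨(F, G, H), by rw [hT, h]⟩)
    (by
      rintro ⟨F, G, H⟩ h
      rw [LinearMap.mem_ker, hT] at h
      have h' := congrArg Subtype.val h
      simp only [gen, Submodule.coe_add, Submodule.coe_smul, smul_eq_mul, ZeroMemClass.coe_zero]
        at h'
      exact (Submodule.Quotient.mk_eq_zero _).mpr (mem_of_combination_eq_zero hij hu he h'))
  refine ⟨SymmetricAlgebra.lift g, fun a b c => ?_⟩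
  have h0 : g (gen i j u v 0) = 0 := by simpa [hT, f] using hg (1, 0, 0)
  have h1 : g (gen i j u v 1) = 0 := by simpa [hT, f] using hg (0, 1, 0)
  have h2 : g (gen i j u v 2) = 1 := by
    have := hg (0, 0, 1)
    rw [hT] at this
    simpa [f] using this
  simp only [symMonomial, map_mul, map_pow, SymmetricAlgebra.lift_ι_apply, h0, h1, h2, one_pow,
    mul_one]
  rw [← pow_add, zero_pow_eq]

theorem mk_pow_ne_zero (hij : i ≠ j) (e : ℕ) :
    Ideal.Quotient.mk (truncIdeal k i j e) (X i ^ e) ≠ 0 := by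
  rw [Ne, Ideal.Quotient.eq_zero_iff_mem, truncIdeal, Ideal.mem_span_pair]
  rintro ⟨a, b, h⟩
  -- Setting y = 0 reduces to xᵉ⁺¹ not dividing xᵉ in one variable.
  have := congrArg (aeval (fun l => if l = i then (Polynomial.X : Polynomial k) else 0)) h
  simp only [map_add, map_mul, map_pow, aeval_X, if_neg hij.symm, if_true, mul_zero,
    zero_add] at this
  have hdvd : (Polynomial.X : Polynomial k) ^ (e + 1) ∣ Polynomial.X ^ e :=
    ⟨_, by rw [← this, mul_comm]⟩
  have := (pow_dvd_pow_iff Polynomial.X_ne_zero Polynomial.not_isUnit_X).mp hdvd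
  omega

theorem mk_pow_eq_zero {e s : ℕ} (h : e < s) :
    Ideal.Quotient.mk (truncIdeal k i j e) (X i ^ s) = 0 :=
  Ideal.Quotient.eq_zero_iff_mem.mpr
    (Ideal.mem_of_dvd _ (pow_dvd_pow _ h) (Ideal.subset_span (by simp)))

theorem mk_X_eq_zero (e : ℕ) : Ideal.Quotient.mk (truncIdeal k i j e) (X j) = 0 :=
  Ideal.Quotient.eq_zero_iff_mem.mpr (Ideal.subset_span (by simp))

theorem not_relations_le_of_record {n : ℕ} (hij : i ≠ j) (hn : 0 < n) (hu : 0 < u)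
    (hrec : ∀ d, 0 < d → d < n + 1 → ((n + 1) * v) % (u + v) < (d * v) % (u + v)) :
    ¬ relations (threeGenIdeal k i j u v) (n + 1) ≤
      symComponent (threeGenIdeal k i j u v) 1 * relations (threeGenIdeal k i j u v) n := by
  classical
  intro hle
  have hdiv := Nat.div_add_mod ((n + 1) * v) (u + v)
  obtain ⟨b, hb⟩ : ∃ b, b = (n + 1) * v / (u + v) := ⟨_, rfl⟩
  obtain ⟨e, he⟩ : ∃ e, e = (n + 1) * v % (u + v) := ⟨_, rfl⟩
  rw [← hb, ← he] at hdiv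
  rw [← he] at hrec
  -- Comparison with d = 1, whose residue is v.
  have hev : e < v := by
    have := hrec 1 one_pos (by omega)
    rwa [one_mul, Nat.mod_eq_of_lt (by omega)] at this
  have hbn : b ≤ n + 1 := by
    rw [hb]
    exact Nat.div_le_of_le_mul (by nlinarith)
  obtain ⟨a, ha⟩ := Nat.exists_eq_add_of_le hbn
  obtain ⟨β, hβ⟩ := exists_algHom_truncIdeal (k := k) (i := i) (j := j) hij hu hev
  have hβfull : ∀ s t a b c, β (fullMonomial k i j u v s t a b c) =
      Ideal.Quotient.mk (truncIdeal k i j e) (X i ^ s * X j ^ t) *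
        if a + b = 0 then 1 else 0 := by
    intro s t a b c
    rw [fullMonomial, map_smul, hβ]
    split_ifs
    · rw [mul_one]
      exact (Submodule.Quotient.mk_smul _ _ _).symm.trans
        (congrArg (Ideal.Quotient.mk _) (mul_one _))
    · rw [mul_zero, smul_zero]
  have hzero : ∀ x ∈ relations (threeGenIdeal k i j u v) n, β x = 0 := by
    intro x hx
    -- On S_n, β factors through α: Zⁿ has weight (u n, v n), so x^{w₁}y^{w₂} must go to x^{w₁ - u
    -- n} if w₂ = v n and to 0 if y remains.
    obtain ⟨L, hL⟩ := exists_addMonoidHom_monomials (k := k) hij fun w₁ w₂ =>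
      if u * n ≤ w₁ ∧ w₂ = v * n then
        Ideal.Quotient.mk (truncIdeal k i j e) (X i ^ (w₁ - u * n)) else 0
    have key := addMonoidHom_eq_of_mem_symComponent hij (F := β.toLinearMap.toAddMonoidHom)
      (G := L.comp (coeffAlpha (threeGenIdeal k i j u v) n).toAddMonoidHom) (n := n)
      (by
        intro r s t a b c habc
        rw [AddMonoidHom.comp_apply, LinearMap.toAddMonoidHom_coe, LinearMap.toAddMonoidHom_coe,
          coeffAlpha_smul_symMonomial _ _ _ _ _ habc, mul_assoc, mul_mul_mul_comm, ← pow_add,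
          ← pow_add, hL, mul_smul, map_smul]
        congr 1
        refine (hβfull s t a b c).trans ?_
        split_ifs with h0 h1 h1
        · obtain ⟨rfl, rfl, rfl⟩ : a = 0 ∧ b = 0 ∧ c = n := by omega
          obtain rfl : t = 0 := by omega
          rw [mul_zero, zero_add, Nat.add_sub_cancel, pow_zero, mul_one, mul_one]
        · obtain ⟨rfl, rfl, rfl⟩ : a = 0 ∧ b = 0 ∧ c = n := by omega
          have ht : t ≠ 0 := by rintro rfl; exact h1 ⟨by omega, by omega⟩
          rw [map_mul, map_pow _ (X j), mk_X_eq_zero, zero_pow ht, mul_zero, zero_mul]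
        -- A term involving X or Y is killed by β although its image may be divisible by that of Zⁿ.
        -- Then the quotient is x^{s+t} with t ≡ (a + b) v modulo p, and recordness gives t > e.
        · rw [mul_zero]
          refine (mk_pow_eq_zero ?_).symm
          obtain ⟨h1, h2⟩ := h1
          have hrec' := hrec (a + b) (by omega) (by omega)
          have ht : t + (u + v) * b = (a + b) * v := by
            rw [← habc] at h2
            nlinarith
          rw [← ht, Nat.add_mul_mod_self_left] at hrec'
          have := hrec'.trans_le (Nat.mod_le _ _)
          have : s + ((u + v) * a + u * c) - u * n = s + t := by
            apply Nat.sub_eq_of_eq_add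
            rw [← habc]
            nlinarith
          omega
        · rw [mul_zero]) hx.1
    rw [AddMonoidHom.comp_apply, LinearMap.toAddMonoidHom_coe, LinearMap.toAddMonoidHom_coe,
      coeffAlpha_eq_zero _ _ _ hx, map_zero] at key
    exact key
  -- The effective relation xᵉZ^{n+1} - yᵉXᵃYᵇ, which β sends to xᵉ ≠ 0.
  have hrel := hle (fullMonomial_sub_mem_relations (k := k) (i := i) (j := j) (u := u) (v := v)
    (n := n + 1) (s := e) (t := 0) (a := 0) (b := 0) (c := n + 1) (s' := 0) (t' := e) (a' := a)
    (b' := b) (c' := 0) (by omega) (by omega)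
    (by
      have : (n + 1) * (u + v) = (b + a) * (u + v) := by rw [ha]
      nlinarith)
    (by nlinarith))
  have hβle : symComponent (threeGenIdeal k i j u v) 1 * relations (threeGenIdeal k i j u v) n ≤
      LinearMap.ker β.toLinearMap := by
    refine Submodule.mul_le.mpr fun x _ y hy => ?_
    rw [LinearMap.mem_ker, AlgHom.toLinearMap_apply, map_mul, hzero y hy, mul_zero]
  have h0 : β _ = 0 := hβle hrel
  rw [map_sub, hβfull, hβfull, if_pos rfl, if_neg (by omega), mul_zero, mul_one, sub_zero,
    pow_zero, mul_one] at h0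
  exact mk_pow_ne_zero hij e h0

/-- The sifted degrees of `(xᵖ, yᵖ, xᵘ yᵛ)`, `p = u + v`, are the records of the residues modulo
`p` of the multiples of `u` or of the multiples of `-u`. -/
theorem mem_siftedDegrees_iff (hij : i ≠ j) (hu : 0 < u) (hv : 0 < v) (n : ℕ) :
    n ∈ siftedDegrees (threeGenIdeal k i j u v) ↔
      0 < n ∧ (IsResidueRecord (u + v) u n ∨ IsResidueRecord (u + v) (-u) n) := by
  -- Modulo u + v, -u is v.
  have hneg : ∀ d : ℕ, ((d : ℤ) * -u) % ((u + v : ℕ) : ℤ) = ((d * v % (u + v) : ℕ) : ℤ) := by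
    intro d
    have : (d : ℤ) * v = (d : ℤ) * -u + ((u + v : ℕ) : ℤ) * d := by push_cast; ring
    rw [Int.natCast_mod, Nat.cast_mul, this, Int.add_mul_emod_self_left]
  have hpos : ∀ d : ℕ, ((d : ℤ) * u) % ((u + v : ℕ) : ℤ) = ((d * u % (u + v) : ℕ) : ℤ) := by
    intro d
    rw [Int.natCast_mod, Nat.cast_mul]
  simp only [IsResidueRecord, hneg, hpos, Nat.cast_lt]
  rcases n with _ | _ | n
  · simp [siftedDegrees]
  · simp [siftedDegrees]
    left
    intro d
    omega
  · have h2 : n + 1 + 1 ∈ siftedDegrees (threeGenIdeal k i j u v) ↔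
        ¬ relations (threeGenIdeal k i j u v) (n + 1 + 1) ≤
          symComponent (threeGenIdeal k i j u v) 1 *
            relations (threeGenIdeal k i j u v) (n + 1) := by
      rw [siftedDegrees, Set.mem_union, Set.mem_singleton_iff, Set.mem_ofPred_eq,
        nontrivial_effectiveRelations_iff, Nat.add_sub_cancel]
      simp
    rw [h2]
    constructor
    · intro h
      refine ⟨by omega, ?_⟩
      by_contra! hcon
      obtain ⟨⟨d, hd, hdn, hd'⟩, ⟨d₂, hd₂, hdn₂, hd₂'⟩⟩ := hcon
      exact h (relations_le_of_not_record hij n.succ_pos hu hv ⟨d₂, hd₂, hdn₂, hd₂'⟩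
        ⟨d, hd, hdn, hd'⟩)
    · rintro ⟨-, h | h⟩
      -- Exchanging the variables exchanges u and v, turning a record for u into one for v.
      · rw [threeGenIdeal_symm]
        rw [add_comm u v] at h
        exact not_relations_le_of_record hij.symm n.succ_pos hv h
      · exact not_relations_le_of_record hij n.succ_pos hu h

theorem mem_siftedDegrees_of_nontrivial {A : Type*} [CommRing A] (I : Ideal A) {n : ℕ}
    (hn : 2 ≤ n) : n ∈ siftedDegrees I ↔ Nontrivial (EffectiveRelations I n) := by
  simp [siftedDegrees, hn, show n ≠ 1 by omega]

theorem relationType_eq_of_isGreatest {A : Type*} [CommRing A] (I : Ideal A) {p : ℕ} (hp : 2 ≤ p)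
    (h : IsGreatest (siftedDegrees I) p) : relationType I = p := by
  have hmem : p ∈ {r | 1 ≤ r ∧ ∀ n, r + 1 ≤ n → Subsingleton (EffectiveRelations I n)} := by
    refine ⟨by omega, fun n hn => ?_⟩
    rw [← not_nontrivial_iff_subsingleton, ← mem_siftedDegrees_of_nontrivial I (by omega)]
    intro hmem
    have := h.2 hmem
    omega
  refine le_antisymm (Nat.sInf_le hmem) (le_csInf ⟨p, hmem⟩ ?_)
  rintro r ⟨-, hr⟩
  by_contra! hlt
  exact not_nontrivial_iff_subsingleton.mpr (hr p hlt)
    ((mem_siftedDegrees_of_nontrivial I hp).mp h.1)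

end

end SiftedDegrees

/-! ### From records to the arithmetic progressions -/

theorem proposition4p1 {k : Type*} [Field k] (p u : ℕ) (hp : 3 ≤ p) (hu : 1 ≤ u)
    (hup : 2 * u < p) (hgcd : Nat.gcd u p = 1)
    (I : Ideal (MvPolynomial (Fin 2) k))
    (hI : I = Ideal.span {MvPolynomial.X 0 ^ p, MvPolynomial.X 1 ^ p,
      MvPolynomial.X 0 ^ u * MvPolynomial.X 1 ^ (p - u)})
    -- Euclid's algorithm applied to `r 0 = p` and `r 1 = u`, with quotients `q 1, …, q (n - 1)`
    (n : ℕ) (r q : ℕ → ℕ) (hr0 : r 0 = p) (hr1 : r 1 = u)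
    (hdiv : ∀ i, 1 ≤ i → i ≤ n - 1 → r (i - 1) = q i * r i + r (i + 1))
    (hdecr : ∀ i, i < n → r (i + 1) < r i) (hrn : r n = 0) :
    (∃ d : ℕ → ℕ → ℕ,
      (d 1 1 = 1 ∧ ∀ j, 2 ≤ j → j ≤ q 1 → d 1 j = d 1 (j - 1) + 1) ∧
      (2 ≤ n - 1 → d 2 1 = d 1 (q 1) + 1 ∧
        ∀ j, 2 ≤ j → j ≤ q 2 → d 2 j = d 2 (j - 1) + d 1 (q 1)) ∧
      (∀ i, 3 ≤ i → i ≤ n - 1 →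
        d i 1 = d (i - 1) (q (i - 1)) + d (i - 2) (q (i - 2)) ∧
        ∀ j, 2 ≤ j → j ≤ q i → d i j = d i (j - 1) + d (i - 1) (q (i - 1))) ∧
      SiftedDegrees.siftedDegrees I = ⋃ i ∈ Set.Icc 1 (n - 1), d i '' Set.Icc 1 (q i) ∧
      d (n - 1) (q (n - 1)) = p) ∧
    IsGreatest (SiftedDegrees.siftedDegrees I) p ∧
    SiftedDegrees.siftedType I = ∑ i ∈ Finset.Icc 1 (n - 1), q i ∧
    SiftedDegrees.relationType I = p := by
  obtain ⟨N, rfl⟩ : ∃ N, n = N + 1 := by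
    rcases n with _ | n
    · omega
    · exact ⟨n, rfl⟩
  have hN : 0 < N := by
    rcases N with _ | N
    · rw [zero_add] at hrn
      omega
    · omega
  rw [Nat.add_sub_cancel] at hdiv ⊢
  have hdiv' : ∀ i < N, r i = q (i + 1) * r (i + 1) + r (i + 2) := fun i hi =>
    hdiv (i + 1) (by omega) (by omega)
  have hdecr' : ∀ i ≤ N, r (i + 1) < r i := fun i hi => hdecr i (by omega)
  have hcop : (r 1).Coprime (r 0) := by rw [hr0, hr1]; exact hgcd
  obtain ⟨v, rfl⟩ := Nat.exists_eq_add_of_le (show u ≤ p by omega)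
  rw [Nat.add_sub_cancel_left] at hI
  have hIeq : I = SiftedDegrees.threeGenIdeal k 0 1 u v := hI
  have hlast := continuant_last hdiv' hcop hrn
  -- With this choice block i ends at d i (q i) = Q_{i+1}, so the common differences and first terms
  -- required are the continuant recursion.
  obtain ⟨d, hd⟩ : ∃ d : ℕ → ℕ → ℕ,
      d = fun i j => continuant q (i - 1) + j * continuant q i := ⟨_, rfl⟩
  have hd1 : ∀ i j, d (i + 1) j = continuant q i + j * continuant q (i + 1) := by simp [hd]
  have hdq : ∀ i, d (i + 1) (q (i + 1)) = continuant q (i + 2) := fun i => by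
    rw [hd1, continuant_succ_succ]
  have hdN : d N (q N) = u + v := by
    obtain ⟨M, rfl⟩ : ∃ M, N = M + 1 := ⟨N - 1, by omega⟩
    rw [hdq, hlast, hr0]
  have hmem : ∀ m, m ∈ SiftedDegrees.siftedDegrees I ↔
      ∃ i < N, ∃ j, 1 ≤ j ∧ j ≤ q (i + 1) ∧ m = d (i + 1) j := by
    intro m
    simp only [hd1]
    rw [hIeq, SiftedDegrees.mem_siftedDegrees_iff (by decide) hu (by omega), ← hr0, ← hr1]
    constructor
    · rintro ⟨hm, h⟩
      exact (isResidueRecord_iff hdiv' hdecr' hN hcop hrn m hm).mp h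
    · intro h
      have hm : 0 < m := by
        obtain ⟨i, hi, j, hj, -, rfl⟩ := h
        have := Nat.mul_pos hj (continuant_pos hdiv' hdecr' i hi.le)
        omega
      exact ⟨hm, (isResidueRecord_iff hdiv' hdecr' hN hcop hrn m hm).mpr h⟩
  have hfin : SiftedDegrees.siftedDegrees I =
      ((Finset.Icc 1 N).biUnion fun i => (Finset.Icc 1 (q i)).image (d i) : Finset ℕ) := by
    ext m
    rw [hmem]
    simp only [Finset.coe_biUnion, Finset.coe_image, Finset.coe_Icc, Set.mem_iUnion, Set.mem_image,
      Set.mem_Icc, exists_prop]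
    constructor
    · rintro ⟨i, hi, j, hj1, hj, rfl⟩
      exact ⟨i + 1, ⟨by omega, by omega⟩, j, ⟨hj1, hj⟩, rfl⟩
    · rintro ⟨i, ⟨hi1, hi⟩, j, ⟨hj1, hj⟩, rfl⟩
      obtain ⟨i, rfl⟩ : ∃ i', i = i' + 1 := ⟨i - 1, by omega⟩
      exact ⟨i, by omega, j, hj1, hj, rfl⟩
  have hgreatest : IsGreatest (SiftedDegrees.siftedDegrees I) (u + v) := by
    constructor
    · rw [hmem]
      refine ⟨N - 1, by omega, q N, ?_, ?_, ?_⟩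
      · have := quotient_pos hdiv' hdecr' (N - 1) (by omega)
        rwa [Nat.sub_add_cancel hN] at this
      · rw [Nat.sub_add_cancel hN]
      · rw [Nat.sub_add_cancel hN, hdN]
    · intro m hm
      obtain ⟨i, hi, j, -, hj, rfl⟩ := (hmem m).mp hm
      have h₁ := continuant_le hdiv' hdecr' (i + 1) N hi le_rfl
      have h₂ := Nat.mul_le_mul_right (continuant q (i + 1)) hj
      rw [continuant_succ_succ] at h₁
      rw [hd1]
      omega
  refine ⟨⟨d, ⟨by simp [hd, continuant], ?_⟩, ?_, ?_, ?_, hdN⟩, hgreatest, ?_,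
    SiftedDegrees.relationType_eq_of_isGreatest I (by omega) hgreatest⟩
  · intro j hj _
    obtain ⟨j, rfl⟩ : ∃ j', j = j' + 1 := ⟨j - 1, by omega⟩
    simp [hd, continuant]
  · intro _
    rw [hdq 0]
    refine ⟨by rw [hd1]; simp [continuant]; omega, fun j hj _ => ?_⟩
    obtain ⟨j, rfl⟩ : ∃ j', j = j' + 1 := ⟨j - 1, by omega⟩
    rw [hd1, hd1, Nat.add_sub_cancel]
    ring
  · intro i hi _
    obtain ⟨i, rfl⟩ : ∃ i', i = i' + 3 := ⟨i - 3, by omega⟩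
    have e1 : i + 3 - 1 = i + 1 + 1 := rfl
    have e2 : i + 3 - 2 = i + 1 := rfl
    rw [e1, e2, hdq, hdq]
    refine ⟨by rw [hd1]; ring, fun j hj _ => ?_⟩
    obtain ⟨j, rfl⟩ : ∃ j', j = j' + 1 := ⟨j - 1, by omega⟩
    rw [hd1, hd1, Nat.add_sub_cancel]
    ring
  · rw [hfin]
    simp
  · rw [SiftedDegrees.siftedType, hfin, Set.ncard_coe_finset]
    exact card_intermediate hdiv' hdecr' d fun i _ j => hd1 i j
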